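/- Let $X,Z$ be complex Banach spaces and $U,U_d,Y$ complex Hilbert spaces. Consider the discrete-time plant $$x_{n+1}=Ax_n+Bu_n+B_dw_n,\qquad y_n=Cx_n+Du_n+D_dw_n,$$ with bounded linear operators $A,B,B_d,C,D,D_d$ between the appropriate spaces, the exosystem $$v_{n+1}=Sv_n,\qquad w_n=Ev_n,\qquad y^{\mathrm{ref}}_n=-Fv_n,\qquad S=\operatorname{diag}(\mu_1,\dots,\mu_q)\in\mathbb C^{q\times q},$$ with $q\ge 1$, $|\mu_k|=1$ for all $k$, $E\in\mathcal L(\mathbb C^q,U_d)$ and $F\in\mathcal L(\mathbb C^q,Y)$, and the error feedback controller $$z_{n+1}=G_1z_n+G_2e_n,\qquad u_n=Kz_n,\qquad e_n=y_n-y^{\mathrm{ref}}_n,$$ with $G_1\in\mathcal L(Z)$, $G_2\in\mathcal L(Y,Z)$, $K\in\mathcal L(Z,U)$. The closed-loop system is called exponentially stable if the operator $$A_e=\begin{pmatrix}A&BK\\ G_2C&G_1+G_2DK\end{pmatrix}\in\mathcal L(X\times Z)$$ satisfies $\|A_e^n\|\le Me^{-\alpha n}$ for all $n\ge 0$ and some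 $M,\alpha>0$. The controller solves the output regulation problem if the closed-loop system is exponentially stable and there are $M,\alpha>0$ such that $$\|y_n-y^{\mathrm{ref}}_n\|\le Me^{-\alpha n}\bigl(\|x_0\|+\|z_0\|+\|v_0\|\bigr)\qquad (n\ge 0)\tag{1}$$ for all $x_0\in X$, $z_0\in Z$, $v_0\in\mathbb C^q$. It solves the robust output regulation problem if, in addition, whenever $(A,B,C,D,E,F)$ is replaced by bounded operators $(\tilde A,\tilde B,\tilde C,\tilde D,\tilde E,\tilde F)$ between the same spaces for which the closed-loop system is still exponentially stable, the estimate (1) holds for the changed system for some $M,\alpha>0$ and all initial states. **Theorem.** Assume that no $\mu_k$ is an interior point of the spectrum $\sigma(A)$ (this holds in particular if the plant is stable, since then $\sigma(A)$ lies in the closed unit disc, and also if $\mu_k\in\rho(A)$ for all $k$), and that the closed-loop system with the controller $(G_1,G_2,K)$ is exponentially stable. Then: 1. $(G_1,G_2,K)$ solves the robust output regulation problem if and only if $$\operatorname{ran}(\mu_k-G_1)\cap\operatorname{ran}(G_2)=\{0\}\quad\text{for all }k\in\{1,\dots,q\},\qquad\text{and}\qquad \ker(G_2)=\{0\}.$$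 2. If $(G_1,G_2,K)$ solves the robust output regulation problem, then $$\dim\ker(\mu_k-G_1)\ge\dim Y\quad\text{for all }k\in\{1,\dots,q\},\tag{2}$$ where $\dim$ is the (possibly infinite) cardinality of an algebraic basis. 3. If $\dim Y<\infty$, then condition (2) is also sufficient for $(G_1,G_2,K)$ to solve the robust output regulation problem. -/

import Mathlib

universe uX uZ uU uD uY

namespace OutputRegulation

/-- The discrete-time plant `x⁺ = A x + B u + B_d w`, `y = C x + D u + D_d w`. -/
structure Plant (X U Ud Y : Type*)
    [NormedAddCommGroup X] [NormedSpace ℂ X]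
    [NormedAddCommGroup U] [NormedSpace ℂ U]
    [NormedAddCommGroup Ud] [NormedSpace ℂ Ud]
    [NormedAddCommGroup Y] [NormedSpace ℂ Y] where
  A : X →L[ℂ] X
  B : U →L[ℂ] X
  Bd : Ud →L[ℂ] X
  C : X →L[ℂ] Y
  D : U →L[ℂ] Y
  Dd : Ud →L[ℂ] Y

/-- The diagonal exosystem `v⁺ = diag(μ₁, …, μ_q) v`, `w = E v`, `y_ref = -F v` on `ℂ^q`. -/
structure Exosystem (q : ℕ) (Ud Y : Type*)
    [NormedAddCommGroup Ud] [NormedSpace ℂ Ud]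
    [NormedAddCommGroup Y] [NormedSpace ℂ Y] where
  μ : Fin q → ℂ
  E : EuclideanSpace ℂ (Fin q) →L[ℂ] Ud
  F : EuclideanSpace ℂ (Fin q) →L[ℂ] Y

/-- The error feedback controller `z⁺ = G₁ z + G₂ e`, `u = K z`. -/
structure Controller (Y Z U : Type*)
    [NormedAddCommGroup Y] [NormedSpace ℂ Y]
    [NormedAddCommGroup Z] [NormedSpace ℂ Z]
    [NormedAddCommGroup U] [NormedSpace ℂ U] where
  G₁ : Z →L[ℂ] Z
  G₂ : Y →L[ℂ] Z
  K : Z →L[ℂ] U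

/-- The system operator `S = diag(μ₁, …, μ_q)` of the exosystem. -/
noncomputable def Exosystem.S {q : ℕ} {Ud Y : Type*}
    [NormedAddCommGroup Ud] [NormedSpace ℂ Ud]
    [NormedAddCommGroup Y] [NormedSpace ℂ Y]
    (exo : Exosystem q Ud Y) :
    EuclideanSpace ℂ (Fin q) →L[ℂ] EuclideanSpace ℂ (Fin q) :=
  Matrix.toEuclideanCLM (𝕜 := ℂ) (Matrix.diagonal exo.μ)

section ClosedLoop

variable {q : ℕ} {X U Ud Y Z : Type*}
  [NormedAddCommGroup X] [NormedSpace ℂ X]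
  [NormedAddCommGroup U] [NormedSpace ℂ U]
  [NormedAddCommGroup Ud] [NormedSpace ℂ Ud]
  [NormedAddCommGroup Y] [NormedSpace ℂ Y]
  [NormedAddCommGroup Z] [NormedSpace ℂ Z]

/-- The closed-loop operator `A_e = [A, B K; G₂ C, G₁ + G₂ D K]` on `X × Z`. -/
noncomputable def closedLoopOperator (P : Plant X U Ud Y) (ctrl : Controller Y Z U) :
    (X × Z) →L[ℂ] (X × Z) :=
  (P.A ∘L ContinuousLinearMap.fst ℂ X Z
      + (P.B ∘L ctrl.K) ∘L ContinuousLinearMap.snd ℂ X Z).prod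
    ((ctrl.G₂ ∘L P.C) ∘L ContinuousLinearMap.fst ℂ X Z
      + (ctrl.G₁ + ctrl.G₂ ∘L P.D ∘L ctrl.K) ∘L ContinuousLinearMap.snd ℂ X Z)

/-- Exponential stability of the closed-loop system: the powers of `A_e` decay exponentially. -/
def ClosedLoopStable (P : Plant X U Ud Y) (ctrl : Controller Y Z U) : Prop :=
  ∃ M > 0, ∃ α > 0, ∀ n : ℕ,
    ‖closedLoopOperator P ctrl ^ n‖ ≤ M * Real.exp (-α * n)

/-- The regulation error `e = y - y_ref` when the plant, the controller and the exosystem are in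
the states `x`, `z` and `v`. -/
noncomputable def regulationError (P : Plant X U Ud Y) (exo : Exosystem q Ud Y)
    (ctrl : Controller Y Z U) (x : X) (z : Z) (v : EuclideanSpace ℂ (Fin q)) : Y :=
  (P.C x + P.D (ctrl.K z) + P.Dd (exo.E v)) - (-(exo.F v))

/-- The states `(x_n, z_n, v_n)` of plant, controller and exosystem in the interconnection with
initial states `x₀`, `z₀`, `v₀`. -/
noncomputable def trajectory (P : Plant X U Ud Y) (exo : Exosystem q Ud Y)
    (ctrl : Controller Y Z U) (x₀ : X) (z₀ : Z) (v₀ : EuclideanSpace ℂ (Fin q)) :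
    ℕ → X × Z × EuclideanSpace ℂ (Fin q)
  | 0 => (x₀, z₀, v₀)
  | n + 1 =>
    let s := trajectory P exo ctrl x₀ z₀ v₀ n
    (P.A s.1 + P.B (ctrl.K s.2.1) + P.Bd (exo.E s.2.2),
      ctrl.G₁ s.2.1 + ctrl.G₂ (regulationError P exo ctrl s.1 s.2.1 s.2.2),
      exo.S s.2.2)

/-- The regulation error `e_n = y_n - y_ref,n` at time `n`. -/
noncomputable def errorAt (P : Plant X U Ud Y) (exo : Exosystem q Ud Y)
    (ctrl : Controller Y Z U) (x₀ : X) (z₀ : Z) (v₀ : EuclideanSpace ℂ (Fin q)) (n : ℕ) : Y :=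
  let s := trajectory P exo ctrl x₀ z₀ v₀ n
  regulationError P exo ctrl s.1 s.2.1 s.2.2

/-- The regulation error decays at a uniform exponential rate for all initial states. -/
def ErrorDecays (P : Plant X U Ud Y) (exo : Exosystem q Ud Y)
    (ctrl : Controller Y Z U) : Prop :=
  ∃ M > 0, ∃ α > 0, ∀ (x₀ : X) (z₀ : Z) (v₀ : EuclideanSpace ℂ (Fin q)) (n : ℕ),
    ‖errorAt P exo ctrl x₀ z₀ v₀ n‖
      ≤ M * Real.exp (-α * n) * (‖x₀‖ + ‖z₀‖ + ‖v₀‖)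

/-- The controller solves the output regulation problem. -/
def SolvesOutputRegulation (P : Plant X U Ud Y) (exo : Exosystem q Ud Y)
    (ctrl : Controller Y Z U) : Prop :=
  ClosedLoopStable P ctrl ∧ ErrorDecays P exo ctrl

/-- The controller solves the robust output regulation problem: it solves the output regulation
problem, and the regulation error still decays after any change of `(A, B, C, D, E, F)` that
preserves the exponential closed-loop stability. -/
def SolvesRobustOutputRegulation (P : Plant X U Ud Y) (exo : Exosystem q Ud Y)
    (ctrl : Controller Y Z U) : Prop :=
  SolvesOutputRegulation P exo ctrl ∧
    ∀ (A' : X →L[ℂ] X) (B' : U →L[ℂ] X) (C' : X →L[ℂ] Y) (D' : U →L[ℂ] Y)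
      (E' : EuclideanSpace ℂ (Fin q) →L[ℂ] Ud) (F' : EuclideanSpace ℂ (Fin q) →L[ℂ] Y),
      ClosedLoopStable { P with A := A', B := B', C := C', D := D' } ctrl →
        ErrorDecays { P with A := A', B := B', C := C', D := D' }
          { exo with E := E', F := F' } ctrl

end ClosedLoop

end OutputRegulation

/-! Since `|μ_k| = 1` and `A_e` is power stable, `μ_k - A_e` is bijective, so each exosystem mode
excites a steady state. The error decays iff its steady-state value `e` vanishes for every mode. As
`(μ_k - G₁) z = G₂ e`, the range and kernel conditions force `e = 0` using nothing about the plant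
but stability: hence robustness. Conversely, let `(μ_k - G₁) z = G₂ y`. A small shift of `A` puts
`μ_k` in its resolvent set, so some `x` completes `z` to a steady state, and a suitable `F` makes
the error `y`; robustness gives `y = 0`. For the dimensions, the transfer map `H` of the shifted
plant sends `ker (μ_k - G₁)` onto `Y` under robustness and is injective there under stability; if
`dim Y < ∞`, counting makes it bijective. -/

namespace OutputRegulation

open Filter Topology

/-! ### Power stability and the unit circle -/

section PowerStability

variable {V : Type*} [NormedAddCommGroup V] [NormedSpace ℂ V]

/-- The powers of `T` decay exponentially. -/
def PowerStable (T : V →L[ℂ] V) : Prop :=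
  ∃ M > 0, ∃ α > 0, ∀ n : ℕ, ‖T ^ n‖ ≤ M * Real.exp (-α * n)

theorem tendsto_const_mul_exp_neg {M α : ℝ} (hα : 0 < α) :
    Tendsto (fun n : ℕ => M * Real.exp (-α * n)) atTop (𝓝 0) := by
  have h : Tendsto (fun n : ℕ => -α * (n : ℝ)) atTop atBot :=
    tendsto_natCast_atTop_atTop.const_mul_atTop_of_neg (neg_lt_zero.2 hα)
  simpa using (Real.tendsto_exp_atBot.comp h).const_mul M

theorem PowerStable.exists_norm_pow_lt_one {T : V →L[ℂ] V} (hT : PowerStable T) :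
    ∃ N : ℕ, 0 < N ∧ ‖T ^ N‖ < 1 := by
  obtain ⟨M, -, α, hα, h⟩ := hT
  obtain ⟨N, hN, hN'⟩ := (((tendsto_const_mul_exp_neg (M := M) hα).eventually_lt_const
    zero_lt_one).and (eventually_gt_atTop 0)).exists
  exact ⟨N, hN', (h N).trans_lt hN⟩

/-- Reduces stability to a single strict inequality, which survives small perturbations of `T`. -/
theorem powerStable_of_norm_pow_lt_one {T : V →L[ℂ] V} {N : ℕ} (hN : 0 < N)
    (hT : ‖T ^ N‖ < 1) : PowerStable T := by
  -- `c` replaces `‖T ^ N‖`, which may be zero and have no usable logarithm.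
  obtain ⟨c, hc₁, hc₂⟩ := exists_between hT
  have hc : 0 < c := (norm_nonneg _).trans_lt hc₁
  have hlog : Real.log c < 0 := Real.log_neg hc hc₂
  have hN' : (0 : ℝ) < N := by exact_mod_cast hN
  set α : ℝ := -Real.log c / N with hαdef
  have hα : 0 < α := div_pos (neg_pos.2 hlog) hN'
  have hcα : c = Real.exp (-α * N) := by
    rw [hαdef, neg_mul, div_mul_cancel₀ _ hN'.ne', neg_neg, Real.exp_log hc]
  set S : ℝ := ∑ r ∈ Finset.range N, ‖T ^ r‖
  have hS : 0 ≤ S := Finset.sum_nonneg fun _ _ => norm_nonneg _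
  have hpow : ∀ m r : ℕ, ‖T ^ (N * m + r)‖ ≤ c ^ m * ‖T ^ r‖ := by
    intro m r
    induction m with
    | zero => simp
    | succ m ih =>
      have h : T ^ (N * (m + 1) + r) = T ^ N * T ^ (N * m + r) := by
        rw [← pow_add]; congr 1; ring
      calc ‖T ^ (N * (m + 1) + r)‖ ≤ ‖T ^ N‖ * ‖T ^ (N * m + r)‖ := by
            rw [h]; exact norm_mul_le _ _
        _ ≤ c * (c ^ m * ‖T ^ r‖) := by gcongr
        _ = c ^ (m + 1) * ‖T ^ r‖ := by ring
  refine ⟨(S + 1) * Real.exp (α * N), by positivity, α, hα, fun n => ?_⟩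
  have hr : n % N < N := Nat.mod_lt _ hN
  have hrS : ‖T ^ (n % N)‖ ≤ S + 1 :=
    (Finset.single_le_sum (f := fun r => ‖T ^ r‖) (fun _ _ => norm_nonneg _)
      (Finset.mem_range.2 hr)).trans (by linarith)
  have hdiv : (n : ℝ) ≤ N * (n / N : ℕ) + N := by
    have := Nat.div_add_mod n N
    exact_mod_cast (by omega : n ≤ N * (n / N) + N)
  -- The factor `exp (α * N)` pays for rounding `n / N` down.
  have hexp : c ^ (n / N) ≤ Real.exp (α * N) * Real.exp (-α * n) := by
    rw [hcα, ← Real.exp_nat_mul, ← Real.exp_add]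
    refine Real.exp_le_exp.2 ?_
    nlinarith
  calc ‖T ^ n‖ = ‖T ^ (N * (n / N) + n % N)‖ := by rw [Nat.div_add_mod]
    _ ≤ c ^ (n / N) * ‖T ^ (n % N)‖ := hpow _ _
    _ ≤ (Real.exp (α * N) * Real.exp (-α * n)) * (S + 1) := by gcongr
    _ = (S + 1) * Real.exp (α * N) * Real.exp (-α * n) := by ring

theorem bijective_smul_sub_of_notMem_spectrum {T : V →L[ℂ] V} {μ : ℂ}
    (h : μ ∉ spectrum ℂ T) : Function.Bijective fun p => μ • p - T p := by
  obtain ⟨u, hu⟩ := spectrum.notMem_iff.1 h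
  have happ : ∀ p, (u : V →L[ℂ] V) p = μ • p - T p := fun p => by
    rw [hu]; simp [Algebra.algebraMap_eq_smul_one]
  have h₁ : ∀ p, (↑u⁻¹ : V →L[ℂ] V) ((u : V →L[ℂ] V) p) = p := fun p => by
    rw [← mul_apply_eq_comp, Units.inv_mul]; rfl
  have h₂ : ∀ p, (u : V →L[ℂ] V) ((↑u⁻¹ : V →L[ℂ] V) p) = p := fun p => by
    rw [← mul_apply_eq_comp, Units.mul_inv]; rfl
  simp_rw [← happ]
  exact ⟨Function.LeftInverse.injective h₁, Function.RightInverse.surjective h₂⟩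

theorem PowerStable.bijective_smul_sub [CompleteSpace V] {T : V →L[ℂ] V} (hT : PowerStable T)
    {μ : ℂ} (hμ : ‖μ‖ = 1) : Function.Bijective fun p => μ • p - T p := by
  refine bijective_smul_sub_of_notMem_spectrum fun hmem => ?_
  obtain ⟨N, -, hN⟩ := hT.exists_norm_pow_lt_one
  have h := spectrum.norm_le_norm_mul_of_mem (spectrum.pow_mem_pow T N hmem)
  rw [norm_pow, hμ, one_pow] at h
  have h₁ : ‖(1 : V →L[ℂ] V)‖ ≤ 1 := ContinuousLinearMap.norm_id_le
  nlinarith [norm_nonneg (T ^ N)]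

end PowerStability

/-! ### Closed loop and steady states -/

section Regulation

variable {q : ℕ} {X U Ud Y Z : Type*}
  [NormedAddCommGroup X] [NormedSpace ℂ X]
  [NormedAddCommGroup U] [NormedSpace ℂ U]
  [NormedAddCommGroup Ud] [NormedSpace ℂ Ud]
  [NormedAddCommGroup Y] [NormedSpace ℂ Y]
  [NormedAddCommGroup Z] [NormedSpace ℂ Z]

theorem closedLoopOperator_apply (P : Plant X U Ud Y) (ctrl : Controller Y Z U) (p : X × Z) :
    closedLoopOperator P ctrl p =
      (P.A p.1 + P.B (ctrl.K p.2), ctrl.G₁ p.2 + ctrl.G₂ (P.C p.1 + P.D (ctrl.K p.2))) := by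
  ext
  · simp [closedLoopOperator]
  · simp [closedLoopOperator]; abel

theorem Exosystem.S_apply (exo : Exosystem q Ud Y) (v : EuclideanSpace ℂ (Fin q)) (k : Fin q) :
    exo.S v k = exo.μ k * v k := by
  simp [Exosystem.S, Matrix.mulVec_diagonal]

theorem Exosystem.S_single (exo : Exosystem q Ud Y) (k : Fin q) :
    exo.S (EuclideanSpace.single k 1) = exo.μ k • EuclideanSpace.single k 1 := by
  ext i
  rw [exo.S_apply]
  by_cases h : i = k
  · subst h; simp
  · simp [h]

/-- `(x, z)` is the steady state of the closed loop excited by the `k`-th exosystem mode. -/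
def IsSteadyState (P : Plant X U Ud Y) (exo : Exosystem q Ud Y) (ctrl : Controller Y Z U)
    (k : Fin q) (x : X) (z : Z) : Prop :=
  exo.μ k • x = P.A x + P.B (ctrl.K z) + P.Bd (exo.E (EuclideanSpace.single k 1)) ∧
    exo.μ k • z = ctrl.G₁ z +
      ctrl.G₂ (regulationError P exo ctrl x z (EuclideanSpace.single k 1))

theorem exists_isSteadyState [CompleteSpace X] [CompleteSpace Z] {P : Plant X U Ud Y}
    {ctrl : Controller Y Z U} (hstab : ClosedLoopStable P ctrl) (exo : Exosystem q Ud Y)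
    {k : Fin q} (hμ : ‖exo.μ k‖ = 1) : ∃ x z, IsSteadyState P exo ctrl k x z := by
  set e : EuclideanSpace ℂ (Fin q) := EuclideanSpace.single k 1
  obtain ⟨⟨x, z⟩, h⟩ := (PowerStable.bijective_smul_sub hstab hμ).2
    (P.Bd (exo.E e), ctrl.G₂ (P.Dd (exo.E e) + exo.F e))
  simp only [closedLoopOperator_apply, Prod.smul_mk, Prod.mk_sub_mk, Prod.mk.injEq,
    sub_eq_iff_eq_add] at h
  refine ⟨x, z, ?_, ?_⟩
  · rw [h.1]; abel
  · rw [h.2]; simp only [regulationError, map_add, sub_neg_eq_add]; abel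

theorem trajectory_of_isSteadyState {P : Plant X U Ud Y} {exo : Exosystem q Ud Y}
    {ctrl : Controller Y Z U} {k : Fin q} {x : X} {z : Z}
    (h : IsSteadyState P exo ctrl k x z) (n : ℕ) :
    trajectory P exo ctrl x z (EuclideanSpace.single k 1) n =
      exo.μ k ^ n • (x, z, EuclideanSpace.single k 1) := by
  induction n with
  | zero => simp [trajectory]
  | succ n ih =>
    obtain ⟨h₁, h₂⟩ := h
    simp only [trajectory, ih, pow_succ, mul_smul, Prod.smul_mk, h₁, h₂, map_smul,
      exo.S_single, smul_add, regulationError, map_add, smul_sub, smul_neg, map_sub, map_neg]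

/-- Started in the steady state, the loop has error `μ_k ^ n • e`, of constant norm. -/
theorem ErrorDecays.regulationError_eq_zero {P : Plant X U Ud Y} {exo : Exosystem q Ud Y}
    {ctrl : Controller Y Z U} (hdec : ErrorDecays P exo ctrl) {k : Fin q}
    (hμ : ‖exo.μ k‖ = 1) {x : X} {z : Z} (h : IsSteadyState P exo ctrl k x z) :
    regulationError P exo ctrl x z (EuclideanSpace.single k 1) = 0 := by
  obtain ⟨M, -, α, hα, hb⟩ := hdec
  have herr : ∀ n, ‖errorAt P exo ctrl x z (EuclideanSpace.single k 1) n‖ =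
      ‖regulationError P exo ctrl x z (EuclideanSpace.single k 1)‖ := by
    intro n
    have : errorAt P exo ctrl x z (EuclideanSpace.single k 1) n =
        exo.μ k ^ n • regulationError P exo ctrl x z (EuclideanSpace.single k 1) := by
      simp only [errorAt, trajectory_of_isSteadyState h, regulationError, Prod.smul_mk, map_smul,
        smul_add, smul_sub, smul_neg]
    rw [this, norm_smul, norm_pow, hμ, one_pow, one_mul]
  have hlim := (tendsto_const_mul_exp_neg (M := M) hα).mul_const
    (‖x‖ + ‖z‖ + ‖(EuclideanSpace.single k 1 : EuclideanSpace ℂ (Fin q))‖)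
  rw [zero_mul] at hlim
  exact norm_le_zero_iff.1 (ge_of_tendsto' hlim fun n => (herr n).symm.le.trans (hb x z _ n))

theorem euclideanSpace_clm_ext {W : Type*} [NormedAddCommGroup W] [NormedSpace ℂ W]
    {f g : EuclideanSpace ℂ (Fin q) →L[ℂ] W}
    (h : ∀ k, f (EuclideanSpace.single k 1) = g (EuclideanSpace.single k 1)) : f = g := by
  refine ContinuousLinearMap.coe_injective
    ((EuclideanSpace.basisFun (Fin q) ℂ).toBasis.ext fun k => ?_)
  simpa using h k

theorem exists_clm_single_eq {W : Type*} [NormedAddCommGroup W] [NormedSpace ℂ W]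
    (w : Fin q → W) :
    ∃ L : EuclideanSpace ℂ (Fin q) →L[ℂ] W, ∀ k, L (EuclideanSpace.single k 1) = w k := by
  refine ⟨LinearMap.toContinuousLinearMap
    ((EuclideanSpace.basisFun (Fin q) ℂ).toBasis.constr ℂ w), fun k => ?_⟩
  simp

/-- The steady states assemble into `L` solving the Sylvester equation `L S = A_e L + B_e`, so `(x,
z) - L v` evolves freely under `A_e`; `C_e L + D_e = 0` removes the persistent part of the error. -/
theorem errorDecays_of_regulationError_eq_zero {P : Plant X U Ud Y} {exo : Exosystem q Ud Y}
    {ctrl : Controller Y Z U} (hstab : ClosedLoopStable P ctrl) (x : Fin q → X) (z : Fin q → Z)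
    (hs : ∀ k, IsSteadyState P exo ctrl k (x k) (z k))
    (herr : ∀ k, regulationError P exo ctrl (x k) (z k) (EuclideanSpace.single k 1) = 0) :
    ErrorDecays P exo ctrl := by
  obtain ⟨L, hL⟩ := exists_clm_single_eq fun k => (x k, z k)
  let Be : EuclideanSpace ℂ (Fin q) →L[ℂ] X × Z :=
    (P.Bd ∘L exo.E).prod (ctrl.G₂ ∘L (P.Dd ∘L exo.E + exo.F))
  let Ce : X × Z →L[ℂ] Y := P.C.coprod (P.D ∘L ctrl.K)
  let De : EuclideanSpace ℂ (Fin q) →L[ℂ] Y := P.Dd ∘L exo.E + exo.F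
  have hsyl : L ∘L exo.S = closedLoopOperator P ctrl ∘L L + Be := by
    refine euclideanSpace_clm_ext fun k => ?_
    obtain ⟨h₁, h₂⟩ := hs k
    simp only [ContinuousLinearMap.comp_apply, add_apply, exo.S_single,
      map_smul, hL, closedLoopOperator_apply, Be, ContinuousLinearMap.prod_apply, Prod.smul_mk,
      h₁, h₂, Prod.mk_add_mk, regulationError, sub_neg_eq_add, map_add]
    ext <;> simp [add_assoc]
  have hreg : Ce ∘L L + De = 0 := by
    refine euclideanSpace_clm_ext fun k => ?_
    simpa [Ce, De, hL, regulationError, add_assoc] using herr k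
  have htraj : ∀ x₀ z₀ v₀ n,
      ((trajectory P exo ctrl x₀ z₀ v₀ n).1, (trajectory P exo ctrl x₀ z₀ v₀ n).2.1) =
        (closedLoopOperator P ctrl ^ n) ((x₀, z₀) - L v₀) +
          L (trajectory P exo ctrl x₀ z₀ v₀ n).2.2 := by
    intro x₀ z₀ v₀ n
    induction n with
    | zero => simp [trajectory]
    | succ n ih =>
      have hS := DFunLike.congr_fun hsyl (trajectory P exo ctrl x₀ z₀ v₀ n).2.2
      simp only [ContinuousLinearMap.comp_apply, add_apply] at hS
      have hstep : ((trajectory P exo ctrl x₀ z₀ v₀ (n + 1)).1,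
          (trajectory P exo ctrl x₀ z₀ v₀ (n + 1)).2.1) =
          closedLoopOperator P ctrl ((trajectory P exo ctrl x₀ z₀ v₀ n).1,
            (trajectory P exo ctrl x₀ z₀ v₀ n).2.1) +
            Be (trajectory P exo ctrl x₀ z₀ v₀ n).2.2 := by
        simp only [trajectory, closedLoopOperator_apply, regulationError, Be, map_add,
          ContinuousLinearMap.prod_apply, ContinuousLinearMap.comp_apply, add_apply,
          Prod.mk_add_mk, Prod.mk.injEq, true_and, sub_neg_eq_add]
        abel
      rw [hstep, ih, map_add, pow_succ', mul_apply_eq_comp]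
      simp only [trajectory]
      rw [hS, add_assoc]
  have herror : ∀ x₀ z₀ v₀ n, errorAt P exo ctrl x₀ z₀ v₀ n =
      Ce ((closedLoopOperator P ctrl ^ n) ((x₀, z₀) - L v₀)) := by
    intro x₀ z₀ v₀ n
    have h₀ := DFunLike.congr_fun hreg (trajectory P exo ctrl x₀ z₀ v₀ n).2.2
    have h₁ := congrArg Ce (htraj x₀ z₀ v₀ n)
    simp only [ContinuousLinearMap.comp_apply, add_apply, zero_apply] at h₀
    rw [map_add, eq_neg_of_add_eq_zero_left h₀, ← sub_eq_add_neg, eq_sub_iff_add_eq] at h₁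
    rw [← h₁]
    simp [errorAt, regulationError, Ce, De, add_assoc]
  obtain ⟨M, hM, α, hα, hb⟩ := hstab
  refine ⟨(‖Ce‖ + 1) * M * (1 + ‖L‖), by positivity, α, hα, fun x₀ z₀ v₀ n => ?_⟩
  have hinit : ‖(x₀, z₀) - L v₀‖ ≤ (1 + ‖L‖) * (‖x₀‖ + ‖z₀‖ + ‖v₀‖) := by
    have h₁ : ‖((x₀, z₀) : X × Z)‖ ≤ ‖x₀‖ + ‖z₀‖ :=
      max_le_add_of_nonneg (norm_nonneg _) (norm_nonneg _)
    have h₂ := (norm_sub_le (x₀, z₀) (L v₀)).trans (add_le_add h₁ (L.le_opNorm v₀))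
    nlinarith [norm_nonneg x₀, norm_nonneg z₀, norm_nonneg v₀, norm_nonneg L,
      mul_nonneg (norm_nonneg L) (add_nonneg (norm_nonneg x₀) (norm_nonneg z₀))]
  rw [herror]
  calc ‖Ce ((closedLoopOperator P ctrl ^ n) ((x₀, z₀) - L v₀))‖
      ≤ ‖Ce‖ * (‖closedLoopOperator P ctrl ^ n‖ * ‖(x₀, z₀) - L v₀‖) :=
        (Ce.le_opNorm _).trans (by gcongr; exact ContinuousLinearMap.le_opNorm _ _)
    _ ≤ (‖Ce‖ + 1) * ((M * Real.exp (-α * n)) *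
          ((1 + ‖L‖) * (‖x₀‖ + ‖z₀‖ + ‖v₀‖))) := by
        gcongr
        · linarith
        · exact hb n
    _ = _ := by ring

/-! ### Perturbing the plant -/

/-- If `μ` is not interior to the spectrum of the state operator, then a small change of that
operator moves `μ` into its resolvent set without destroying closed-loop stability. -/
theorem exists_perturbation {P : Plant X U Ud Y} {ctrl : Controller Y Z U}
    (hstab : ClosedLoopStable P ctrl) {μ : ℂ} (hμ : μ ∉ interior (spectrum ℂ P.A)) :
    ∃ A' : X →L[ℂ] X, ClosedLoopStable { P with A := A' } ctrl ∧
      Function.Bijective fun x => μ • x - A' x := by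
  obtain ⟨N, hN, hlt⟩ := PowerStable.exists_norm_pow_lt_one hstab
  let J : X × Z →L[ℂ] X × Z :=
    ContinuousLinearMap.inl ℂ X Z ∘L ContinuousLinearMap.fst ℂ X Z
  have hcont : Continuous fun l : ℂ => ‖(closedLoopOperator P ctrl + (μ - l) • J) ^ N‖ := by
    fun_prop
  have hnear : ∀ᶠ l in 𝓝 μ, ‖(closedLoopOperator P ctrl + (μ - l) • J) ^ N‖ < 1 :=
    hcont.continuousAt.eventually_lt_const (by simpa using hlt)
  have hfreq : ∃ᶠ l in 𝓝 μ, l ∉ spectrum ℂ P.A := fun h =>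
    hμ (mem_interior_iff_mem_nhds.2 (h.mono fun _ => not_not.1))
  obtain ⟨l, hl, hl'⟩ := (hfreq.and_eventually hnear).exists
  -- With this choice `μ - A' = l - A`, and `l` lies in the resolvent set of `A`.
  refine ⟨P.A + (μ - l) • ContinuousLinearMap.id ℂ X, ?_, ?_⟩
  · refine powerStable_of_norm_pow_lt_one hN ?_
    convert hl' using 3
    refine ContinuousLinearMap.ext fun p => ?_
    rw [add_apply, closedLoopOperator_apply, closedLoopOperator_apply]
    simp [J, add_right_comm]
  · convert bijective_smul_sub_of_notMem_spectrum hl using 2 with x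
    simp only [add_apply, smul_apply, ContinuousLinearMap.id_apply]
    rw [sub_smul]
    abel

theorem ClosedLoopStable.eq_zero [CompleteSpace X] [CompleteSpace Z] {P : Plant X U Ud Y}
    {ctrl : Controller Y Z U} (hstab : ClosedLoopStable P ctrl) {μ : ℂ} (hμ : ‖μ‖ = 1)
    {x : X} {z : Z} (hx : μ • x - P.A x = P.B (ctrl.K z))
    (hz : μ • z - ctrl.G₁ z = ctrl.G₂ (P.C x + P.D (ctrl.K z))) : x = 0 ∧ z = 0 := by
  have h : ((x, z) : X × Z) = 0 := (PowerStable.bijective_smul_sub hstab hμ).1 <| by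
    simp only [closedLoopOperator_apply, Prod.smul_mk, Prod.mk_sub_mk, map_zero, smul_zero,
      sub_zero]
    rw [← hx, ← hz]
    simp
  exact Prod.mk_eq_zero.1 h

/-! ### Robustness and the range and kernel conditions -/

/-- The `𝒢`-conditions on a controller at the frequencies `μ`. -/
def GConditions (μ : Fin q → ℂ) (ctrl : Controller Y Z U) : Prop :=
  (∀ k z y, μ k • z - ctrl.G₁ z = ctrl.G₂ y → ctrl.G₂ y = 0) ∧ ∀ y, ctrl.G₂ y = 0 → y = 0

theorem gConditions_iff {μ : Fin q → ℂ} {ctrl : Controller Y Z U} :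
    GConditions μ ctrl ↔
      (∀ k, LinearMap.range (μ k • ContinuousLinearMap.id ℂ Z - ctrl.G₁).toLinearMap
          ⊓ LinearMap.range ctrl.G₂.toLinearMap = ⊥) ∧
        LinearMap.ker ctrl.G₂.toLinearMap = ⊥ := by
  refine and_congr (forall_congr' fun k => ?_) LinearMap.ker_eq_bot'.symm
  rw [Submodule.eq_bot_iff]
  constructor
  · rintro h _ ⟨⟨z, hz⟩, ⟨y, rfl⟩⟩
    exact h z y (by simpa using hz)
  · intro h z y hzy
    exact h _ ⟨⟨z, by simpa using hzy⟩, ⟨y, rfl⟩⟩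

theorem GConditions.errorDecays [CompleteSpace X] [CompleteSpace Z] {P : Plant X U Ud Y}
    {exo : Exosystem q Ud Y} {ctrl : Controller Y Z U} (hG : GConditions exo.μ ctrl)
    (hμ : ∀ k, ‖exo.μ k‖ = 1) (hstab : ClosedLoopStable P ctrl) : ErrorDecays P exo ctrl := by
  choose x z hs using fun k => exists_isSteadyState hstab exo (hμ k)
  refine errorDecays_of_regulationError_eq_zero hstab x z hs fun k => hG.2 _ ?_
  exact hG.1 k (z k) _ (sub_eq_iff_eq_add'.2 (hs k).2)

theorem GConditions.solvesRobustOutputRegulation [CompleteSpace X] [CompleteSpace Z]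
    {P : Plant X U Ud Y} {exo : Exosystem q Ud Y} {ctrl : Controller Y Z U}
    (hG : GConditions exo.μ ctrl) (hμ : ∀ k, ‖exo.μ k‖ = 1)
    (hstab : ClosedLoopStable P ctrl) : SolvesRobustOutputRegulation P exo ctrl :=
  ⟨⟨hstab, hG.errorDecays hμ hstab⟩, fun _ _ _ _ _ _ hstab' =>
    GConditions.errorDecays (exo := { exo with E := _, F := _ }) hG hμ hstab'⟩

/-- Under robust regulation, any steady state of a stable perturbed loop in which the reference
signal makes the regulation error equal to `y` forces `y = 0`. -/
theorem SolvesRobustOutputRegulation.eq_zero {P : Plant X U Ud Y} {exo : Exosystem q Ud Y}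
    {ctrl : Controller Y Z U} (hrob : SolvesRobustOutputRegulation P exo ctrl) {k : Fin q}
    (hμ : ‖exo.μ k‖ = 1) {A' : X →L[ℂ] X}
    (hstab : ClosedLoopStable { P with A := A' } ctrl) {x : X} {z : Z} {y : Y}
    (hx : exo.μ k • x - A' x = P.B (ctrl.K z)) (hz : exo.μ k • z - ctrl.G₁ z = ctrl.G₂ y) :
    y = 0 := by
  obtain ⟨F', hF'⟩ := exists_clm_single_eq (q := q) fun _ => y - (P.C x + P.D (ctrl.K z))
  have hdec := hrob.2 A' P.B P.C P.D 0 F' hstab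
  have herr : regulationError { P with A := A' } { exo with E := 0, F := F' } ctrl x z
      (EuclideanSpace.single k 1) = y := by
    simp [regulationError, hF']
  rw [← herr]
  refine hdec.regulationError_eq_zero hμ ⟨?_, ?_⟩
  · simpa using sub_eq_iff_eq_add'.1 hx
  · rw [herr]
    exact sub_eq_iff_eq_add'.1 hz

theorem SolvesRobustOutputRegulation.gConditions {P : Plant X U Ud Y} {exo : Exosystem q Ud Y}
    {ctrl : Controller Y Z U} (hrob : SolvesRobustOutputRegulation P exo ctrl) (hq : 0 < q)
    (hμ : ∀ k, ‖exo.μ k‖ = 1) (hA : ∀ k, exo.μ k ∉ interior (spectrum ℂ P.A)) :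
    GConditions exo.μ ctrl := by
  refine ⟨fun k z y hzy => ?_, fun y hy => ?_⟩
  · obtain ⟨A', hstab', hbij⟩ := exists_perturbation hrob.1.1 (hA k)
    obtain ⟨x, hx⟩ := hbij.2 (P.B (ctrl.K z))
    rw [hrob.eq_zero (hμ k) hstab' hx hzy, map_zero]
  -- If `G₂ y = 0`, the zero state is steady with error `y`; a mode exists since `q > 0`.
  · exact hrob.eq_zero (k := ⟨0, hq⟩) (hμ _) (A' := P.A) hrob.1.1 (x := 0) (z := 0)
      (by simp) (by simp [hy])

/-! ### Dimension of the kernels -/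

theorem mem_ker_smul_id_sub {μ : ℂ} {G : Z →L[ℂ] Z} {z : Z} :
    z ∈ LinearMap.ker (μ • ContinuousLinearMap.id ℂ Z - G).toLinearMap ↔ μ • z - G z = 0 := by
  simp

/-- The transfer map of the plant at `μ`, precomposed with `K`, when `μ` is in the resolvent set
of `A`: the output `C x + D K z`, where `x` solves `(μ - A) x = B K z`. -/
theorem exists_transferMap (P : Plant X U Ud Y) (ctrl : Controller Y Z U) {μ : ℂ}
    (hbij : Function.Bijective fun x => μ • x - P.A x) :
    ∃ (R : Z →ₗ[ℂ] X) (H : Z →ₗ[ℂ] Y), (∀ z, μ • R z - P.A (R z) = P.B (ctrl.K z)) ∧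
      ∀ z, H z = P.C (R z) + P.D (ctrl.K z) := by
  let e : X ≃ₗ[ℂ] X :=
    LinearEquiv.ofBijective (μ • ContinuousLinearMap.id ℂ X - P.A).toLinearMap
      hbij
  let R : Z →ₗ[ℂ] X := e.symm.toLinearMap ∘ₗ (P.B ∘L ctrl.K).toLinearMap
  refine ⟨R, P.C.toLinearMap ∘ₗ R + (P.D ∘L ctrl.K).toLinearMap, fun z => ?_, fun z => rfl⟩
  exact e.apply_symm_apply (P.B (ctrl.K z))

theorem SolvesRobustOutputRegulation.lift_rank_le {X : Type uX} {U : Type uU} {Ud : Type uD}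
    {Y : Type uY} {Z : Type uZ}
    [NormedAddCommGroup X] [NormedSpace ℂ X] [CompleteSpace X]
    [NormedAddCommGroup U] [NormedSpace ℂ U]
    [NormedAddCommGroup Ud] [NormedSpace ℂ Ud]
    [NormedAddCommGroup Y] [NormedSpace ℂ Y]
    [NormedAddCommGroup Z] [NormedSpace ℂ Z] [CompleteSpace Z]
    {P : Plant X U Ud Y} {exo : Exosystem q Ud Y} {ctrl : Controller Y Z U}
    (hrob : SolvesRobustOutputRegulation P exo ctrl) {k : Fin q} (hμ : ‖exo.μ k‖ = 1)
    (hA : exo.μ k ∉ interior (spectrum ℂ P.A)) :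
    Cardinal.lift.{uZ} (Module.rank ℂ Y) ≤ Cardinal.lift.{uY} (Module.rank ℂ
      (LinearMap.ker (exo.μ k • ContinuousLinearMap.id ℂ Z - ctrl.G₁).toLinearMap)) := by
  obtain ⟨A', hstab', hbij⟩ := exists_perturbation hrob.1.1 hA
  obtain ⟨R, H, hR, hH⟩ := exists_transferMap { P with A := A' } ctrl hbij
  set N := LinearMap.ker (exo.μ k • ContinuousLinearMap.id ℂ Z - ctrl.G₁).toLinearMap
  refine LinearMap.lift_rank_le_of_surjective (H.domRestrict N) fun y => ?_
  -- The reference is `y`; perfect tracking puts `z` in the kernel with `H z = y`.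
  obtain ⟨F', hF'⟩ := exists_clm_single_eq (q := q) fun _ => -y
  obtain ⟨x, z, hs⟩ := exists_isSteadyState hstab' { exo with E := 0, F := F' } (k := k) hμ
  have herr := (hrob.2 A' P.B P.C P.D 0 F' hstab').regulationError_eq_zero hμ hs
  obtain ⟨h₁, h₂⟩ := hs
  rw [herr, map_zero, add_zero] at h₂
  have hx : x = R z := hbij.1 <| by
    refine (sub_eq_iff_eq_add'.2 ?_).trans (hR z).symm
    simpa using h₁
  refine ⟨⟨z, mem_ker_smul_id_sub.2 (sub_eq_zero.2 h₂)⟩, ?_⟩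
  rw [LinearMap.domRestrict_apply, hH, ← hx]
  simpa [regulationError, hF', ← sub_eq_add_neg, sub_eq_zero] using herr

theorem gConditions_of_lift_rank_le {X : Type uX} {U : Type uU} {Ud : Type uD}
    {Y : Type uY} {Z : Type uZ}
    [NormedAddCommGroup X] [NormedSpace ℂ X] [CompleteSpace X]
    [NormedAddCommGroup U] [NormedSpace ℂ U]
    [NormedAddCommGroup Ud] [NormedSpace ℂ Ud]
    [NormedAddCommGroup Y] [NormedSpace ℂ Y] [FiniteDimensional ℂ Y]
    [NormedAddCommGroup Z] [NormedSpace ℂ Z] [CompleteSpace Z]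
    {P : Plant X U Ud Y} {μ : Fin q → ℂ} {ctrl : Controller Y Z U}
    (hstab : ClosedLoopStable P ctrl) (hq : 0 < q) (hμ : ∀ k, ‖μ k‖ = 1)
    (hA : ∀ k, μ k ∉ interior (spectrum ℂ P.A))
    (hrank : ∀ k, Cardinal.lift.{uZ} (Module.rank ℂ Y) ≤ Cardinal.lift.{uY} (Module.rank ℂ
      (LinearMap.ker (μ k • ContinuousLinearMap.id ℂ Z - ctrl.G₁).toLinearMap))) :
    GConditions μ ctrl := by
  have key : ∀ k z y, μ k • z - ctrl.G₁ z = ctrl.G₂ y → y = 0 := by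
    intro k z y hzy
    obtain ⟨A', hstab', hbij⟩ := exists_perturbation hstab (hA k)
    obtain ⟨R, H, hR, hH⟩ := exists_transferMap { P with A := A' } ctrl hbij
    have hzero : ∀ z, μ k • z - ctrl.G₁ z = ctrl.G₂ (H z) → z = 0 := fun z hz =>
      (hstab'.eq_zero (hμ k) (hR z) (by rw [hz, hH])).2
    set N := LinearMap.ker (μ k • ContinuousLinearMap.id ℂ Z - ctrl.G₁).toLinearMap
    have hinj : Function.Injective (H.domRestrict N) := by
      rw [← LinearMap.ker_eq_bot, LinearMap.ker_eq_bot']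
      rintro ⟨w, hw⟩ hHw
      rw [LinearMap.domRestrict_apply] at hHw
      exact Subtype.ext (hzero w (by rw [hHw, map_zero]; exact mem_ker_smul_id_sub.1 hw))
    have : FiniteDimensional ℂ N := Module.Finite.of_injective _ hinj
    have hfin : Module.finrank ℂ N = Module.finrank ℂ Y := by
      refine le_antisymm (LinearMap.finrank_le_finrank_of_injective hinj) ?_
      have h := hrank k
      rw [← Module.finrank_eq_rank, ← Module.finrank_eq_rank, Cardinal.lift_natCast,
        Cardinal.lift_natCast] at h
      exact_mod_cast h
    -- Subtracting a kernel element `w` keeps `(μ_k - G₁) z` but changes the plant output to `y`, so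
    -- `z - w` gives a kernel vector of `μ_k - A_e` for the shifted plant and vanishes.
    obtain ⟨⟨w, hw⟩, hHw⟩ :=
      (LinearMap.injective_iff_surjective_of_finrank_eq_finrank hfin).1 hinj (H z - y)
    rw [LinearMap.domRestrict_apply] at hHw
    have hHzw : H (z - w) = y := by rw [map_sub, hHw]; abel
    have hw' := mem_ker_smul_id_sub.1 hw
    have hzw : z - w = 0 := hzero _ <| by
      rw [hHzw, ← hzy, smul_sub, map_sub, sub_sub_sub_comm, hw', sub_zero]
    rw [← hHzw, hzw, map_zero]
  exact ⟨fun k z y h => by rw [key k z y h, map_zero],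
    fun y hy => key ⟨0, hq⟩ 0 y (by simp [hy])⟩

end Regulation

end OutputRegulation

theorem mainTheorem5
    {X : Type uX} [NormedAddCommGroup X] [NormedSpace ℂ X] [CompleteSpace X]
    {Z : Type uZ} [NormedAddCommGroup Z] [NormedSpace ℂ Z] [CompleteSpace Z]
    {U : Type uU} [NormedAddCommGroup U] [InnerProductSpace ℂ U] [CompleteSpace U]
    {Ud : Type uD} [NormedAddCommGroup Ud] [InnerProductSpace ℂ Ud] [CompleteSpace Ud]
    {Y : Type uY} [NormedAddCommGroup Y] [InnerProductSpace ℂ Y] [CompleteSpace Y]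
    {q : ℕ} (hq : 0 < q)
    (P : OutputRegulation.Plant X U Ud Y)
    (exo : OutputRegulation.Exosystem q Ud Y)
    (ctrl : OutputRegulation.Controller Y Z U)
    (hμ : ∀ k, ‖exo.μ k‖ = 1)
    (hA : ∀ k, exo.μ k ∉ interior (spectrum ℂ P.A))
    (hstab : OutputRegulation.ClosedLoopStable P ctrl) :
    (OutputRegulation.SolvesRobustOutputRegulation P exo ctrl ↔
      (∀ k, LinearMap.range (exo.μ k • ContinuousLinearMap.id ℂ Z - ctrl.G₁).toLinearMap
          ⊓ LinearMap.range ctrl.G₂.toLinearMap = ⊥) ∧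
        LinearMap.ker ctrl.G₂.toLinearMap = ⊥) ∧
    (OutputRegulation.SolvesRobustOutputRegulation P exo ctrl →
      ∀ k, Cardinal.lift.{uZ} (Module.rank ℂ Y) ≤ Cardinal.lift.{uY} (Module.rank ℂ
        (LinearMap.ker (exo.μ k • ContinuousLinearMap.id ℂ Z - ctrl.G₁).toLinearMap))) ∧
    (FiniteDimensional ℂ Y →
      (∀ k, Cardinal.lift.{uZ} (Module.rank ℂ Y) ≤ Cardinal.lift.{uY} (Module.rank ℂ
        (LinearMap.ker (exo.μ k • ContinuousLinearMap.id ℂ Z - ctrl.G₁).toLinearMap))) →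
      OutputRegulation.SolvesRobustOutputRegulation P exo ctrl) := by
  have hrob : OutputRegulation.SolvesRobustOutputRegulation P exo ctrl ↔
      OutputRegulation.GConditions exo.μ ctrl :=
    ⟨fun h => h.gConditions hq hμ hA, fun h => h.solvesRobustOutputRegulation hμ hstab⟩
  refine ⟨hrob.trans OutputRegulation.gConditions_iff, fun h k => h.lift_rank_le (hμ k) (hA k),
    fun _ hrank => hrob.2 (OutputRegulation.gConditions_of_lift_rank_le hstab hq hμ hA hrank)⟩
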